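/- Let $(\mathcal C,\mathfrak C)$ be a measurable space (the cake; the sets in $\mathfrak C$ are the slices), and let $\mathcal L$ consist of the non-atomic probability measures on it and the zero measure. (A measure is non-atomic if every measurable set of positive measure has a measurable subset of strictly smaller positive measure.) Let $\mathcal L^\infty$ be the set of sequences $v=(v_i)_{i\ge 0}$ in $\mathcal L$ with finitely many nonzero entries; the indices are identities, and those with $v_i\neq 0$ are the participants. A *mechanism* is a probability space $(\Omega,\Pr)$ with a map $\mathfrak A:\mathcal L^\infty\times\Omega\to\mathfrak C^{\mathbb N}$ such that * for each $v$, $\mathfrak A(v,\cdot)$ is measurable, where $\mathfrak C$ carries the coarsest $\sigma$-algebra making $C\mapsto\mu(C)$ measurable for all $\mu\in\mathcal L$, and $\mathfrak C^{\mathbb N}$ the product $\sigma$-algebra; * $\mathfrak A(v,\omega)_i\cap\mathfrak A(v,\omega)_j=\emptyset$ for $i\ne j$, and $\mathfrak A(v,\omega)_i=\emptyset$ if $v_i=0$; * (symmetry) for every $v$ and every permutation $\sigma$ of the identities, $(\mathfrak A(v,\cdot)_i)_i$ and $(\mathfrak A(\sigma(v),\cdot)_{\sigma(i)})_i$ have the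 same law, where $\sigma(v)_{\sigma(i)}=v_i$. A mechanism is *truthful* if $\mathbb E[\mu(\mathfrak A(\mu,v_{-i})_i)]\ge\mathbb E[\mu(\mathfrak A(\nu,v_{-i})_i)]$ for all $\mu,\nu\in\mathcal L$, $v\in\mathcal L^\infty$ and $i$. It is *Sybil-proof* if a player who, instead of reporting the true valuation $v_i$ under the single identity $i$, controls any finite set $S\ni i$ of identities not used by others and makes arbitrary reports under them does not gain: for all $v,u\in\mathcal L^\infty$ with $v_j=0$ for $j\in S\setminus\{i\}$ and $u_j=v_j$ for $j\notin S$, $$\mathbb E[v_i(\mathfrak A(v)_i)]\ \ge\ \mathbb E\Big[\sum_{j\in S}v_i(\mathfrak A(u)_j)\Big].$$ It is *$1/2^{n-1}$-proportional in expectation* if $\mathbb E[v_i(\mathfrak A(v)_i)]\ge 1/2^{n-1}$ for every $v\in\mathcal L^\infty$ with $n\ge1$ participants and every participant $i$. A mechanism is a *perfect-partition lottery* if, for every $v$ with $n\ge 1$ participants, there are a partition of $\mathcal C$ into $n$ slices (one labelled by each participant), each of which has value exactly $1/n$ under every reported measure, a uniformly random permutation $\sigma$ of the participants, and an independent coin $X$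 with $\Pr[X=1]=n/2^{n-1}$, such that participant $i$ gets the slice with label $\sigma(i)$ if $X=1$, and the empty set otherwise. Then: 1. A perfect-partition lottery exists (for every $(\mathcal C,\mathfrak C)$). 2. Every perfect-partition lottery is truthful, Sybil-proof and $1/2^{n-1}$-proportional in expectation. 3. If $(\mathcal C,\mathfrak C)$ carries at least one non-atomic probability measure, then for every $n\ge1$ $$\max_{\mathfrak A\in\mathcal M}\ \inf_{\mu_1,\dots,\mu_n}\ \mathbb E\Big[\sum_{i=1}^n\mu_i(\mathfrak A(\mu)_i)\Big]=\frac{n}{2^{n-1}},$$ where $\mathcal M$ is the set of truthful Sybil-proof mechanisms, the infimum is over all $n$-tuples of non-atomic probability measures, and $\mu$ is the profile with reports $\mu_1,\dots,\mu_n$ and zeros elsewhere. Moreover, for every perfect-partition lottery the infimum is a minimum and equals $n/2^{n-1}$. -/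

import Mathlib

universe u w

open MeasureTheory

noncomputable section

namespace CakeCutting

/-- `μ` is non-atomic: every measurable set of positive measure has a measurable subset of
strictly smaller positive measure. (Mathlib's `NoAtoms` only says that points are null, which is
weaker on a general measurable space.) -/
def Nonatomic {C : Type u} [MeasurableSpace C] (μ : Measure C) : Prop :=
  ∀ s, MeasurableSet s → 0 < μ s → ∃ t, t ⊆ s ∧ MeasurableSet t ∧ 0 < μ t ∧ μ t < μ s

/-- The valuations: the non-atomic probability measures on the cake `C`, and the zero measure,
which stands for an identity that does not take part. -/
def Valuation (C : Type u) [MeasurableSpace C] : Type u :=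
  {μ : Measure C // μ = 0 ∨ (IsProbabilityMeasure μ ∧ Nonatomic μ)}

instance (C : Type u) [MeasurableSpace C] : Zero (Valuation C) := ⟨⟨0, Or.inl rfl⟩⟩

/-- The slices of the cake: the measurable subsets. -/
def Slice (C : Type u) [MeasurableSpace C] : Type u := {s : Set C // MeasurableSet s}

/-- The value of a slice under a valuation. -/
def Valuation.value {C : Type u} [MeasurableSpace C] (μ : Valuation C) (s : Slice C) : ℝ :=
  μ.1.real s.1

/-- The coarsest σ-algebra on the slices for which every valuation is a measurable function of
the slice; random slices are measurable with respect to it. -/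
instance (C : Type u) [MeasurableSpace C] : MeasurableSpace (Slice C) :=
  ⨆ μ : Valuation C, MeasurableSpace.comap μ.value inferInstance

/-- Report profiles: sequences of valuations with finitely many nonzero entries. The identities
taking part are those in the support. -/
abbrev Profile (C : Type u) [MeasurableSpace C] : Type u := ℕ →₀ Valuation C

/-- A cake-cutting mechanism for a finite but unbounded number of identities: a random allocation
rule. Slices of different identities are disjoint, identities that do not take part get
nothing, and the rule is symmetric: renaming the identities by `σ` renames the random
allocation accordingly, as an equality of laws of the joint allocation. -/
structure Mechanism (C : Type u) [MeasurableSpace C] where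
  Ω : Type w
  [mΩ : MeasurableSpace Ω]
  P : Measure Ω
  [prob : IsProbabilityMeasure P]
  alloc : Profile C → Ω → ℕ → Slice C
  measurable_alloc : ∀ v, Measurable (alloc v)
  disjoint_alloc : ∀ v ω i j, i ≠ j → Disjoint (alloc v ω i).1 (alloc v ω j).1
  alloc_inactive : ∀ v ω i, v i = 0 → (alloc v ω i).1 = ∅
  symmetric : ∀ (v : Profile C) (σ : Equiv.Perm ℕ),
    P.map (fun ω i => alloc v ω i) =
      P.map (fun ω i => alloc (Finsupp.equivMapDomain σ v) ω (σ i))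

namespace Mechanism

variable {C : Type u} [MeasurableSpace C]

/-- Expected value, under `μ`, of the slice that identity `i` gets when the reports are `v`. -/
def payoff (A : Mechanism.{u, w} C) (μ : Valuation C) (v : Profile C) (i : ℕ) : ℝ :=
  letI := A.mΩ
  ∫ ω, μ.value (A.alloc v ω i) ∂A.P

/-- Truthful in expectation: an identity with true valuation `μ` does not gain by reporting `ν`,
whatever the others report. -/
def Truthful (A : Mechanism.{u, w} C) : Prop :=
  ∀ (v : Profile C) (i : ℕ) (μ ν : Valuation C),
    A.payoff μ (v.update i ν) i ≤ A.payoff μ (v.update i μ) i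

/-- Sybil-proof: let a player with true valuation `v i` report it once, under the identity `i`,
giving the profile `v`. If instead the player controls a finite set `S ∋ i` of identities, none
of them used by another player, and reports anything under them, which gives a profile `u` that
agrees with `v` outside `S`, then the total expected value obtained is not larger. -/
def SybilProof (A : Mechanism.{u, w} C) : Prop :=
  ∀ (v u : Profile C) (i : ℕ) (S : Finset ℕ), i ∈ S →
    (∀ j ∈ S, j ≠ i → v j = 0) → (∀ j, j ∉ S → u j = v j) →
    ∑ j ∈ S, A.payoff (v i) u j ≤ A.payoff (v i) v i

/-- `α`-proportional in expectation, where `α` may depend on the number of participants. -/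
def ProportionalInExpectation (A : Mechanism.{u, w} C) (α : ℕ → ℝ) : Prop :=
  ∀ (v : Profile C) (i : ℕ), v i ≠ 0 → α v.support.card ≤ A.payoff (v i) v i

end Mechanism

/-- `D` is a perfect partition for the profile `v`: a partition of the cake into `n` slices,
`n` the number of participants (whose identities serve as labels of the slices), such that every
reported measure gives every slice the value `1 / n`. -/
structure IsPerfectPartition {C : Type u} [MeasurableSpace C] (v : Profile C)
    (D : v.support → Slice C) : Prop where
  disjoint : ∀ i j, i ≠ j → Disjoint (D i).1 (D j).1
  cover : ⋃ i, (D i).1 = Set.univ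
  fair : ∀ i j : v.support, (v i).value (D j) = 1 / (v.support.card : ℝ)

namespace Mechanism

variable {C : Type u} [MeasurableSpace C]

/-- The perfect-partition lottery. On every profile with `n ≥ 1` participants: take a perfect
partition `D` of the reports, a uniformly random permutation `σ` of the participants, and an
independent coin `X` with `Pr[X = 1] = n / 2 ^ (n - 1)`; if `X = 1`, the participant `i` gets
`D (σ i)`, otherwise everybody gets the empty slice. -/
def IsPerfectPartitionLottery (A : Mechanism.{u, w} C) : Prop :=
  letI := A.mΩ
  ∀ v : Profile C, v ≠ 0 →
    ∃ (D : v.support → Slice C) (σ : A.Ω → Equiv.Perm v.support) (X : A.Ω → Bool),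
      IsPerfectPartition v D ∧
      (∀ τ, MeasurableSet {ω | σ ω = τ}) ∧
      MeasurableSet {ω | X ω = true} ∧
      (∀ τ, A.P.real {ω | σ ω = τ} = 1 / (v.support.card.factorial : ℝ)) ∧
      A.P.real {ω | X ω = true} = (v.support.card : ℝ) / 2 ^ (v.support.card - 1) ∧
      (∀ τ, ProbabilityTheory.IndepSet {ω | σ ω = τ} {ω | X ω = true} A.P) ∧
      ∀ (ω : A.Ω) (i : v.support),
        (A.alloc v ω i).1 = if X ω = true then (D (σ ω i)).1 else ∅

/-- The expected social welfare when `n` players with valuations `μ 0, …, μ (n - 1)` report them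
truthfully, each under one identity. -/
def welfare (A : Mechanism.{u, w} C) (n : ℕ) (μ : Fin n → {μ : Valuation C // μ ≠ 0}) : ℝ :=
  ∑ i : Fin n, A.payoff (μ i).1
    (Finsupp.embDomain Fin.valEmbedding (Finsupp.equivFunOnFinite.symm fun k => (μ k).1)) i

/-- The worst-case welfare over all `n`-tuples of non-atomic probability measures. -/
def worstCaseWelfare (A : Mechanism.{u, w} C) (n : ℕ) : ℝ :=
  ⨅ μ : Fin n → {μ : Valuation C // μ ≠ 0}, A.welfare n μ

end Mechanism

end CakeCutting

end

/-! Upper bound: let `n` players report the same measure, and let `p n` be the payoff of each, which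
is common to all by symmetry. A player who adds one clone turns this profile into the one with `n +
1` copies and collects `2 * p (n + 1)`, so Sybil-proofness gives `2 * p (n + 1) ≤ p n`. Since `p 1 ≤
1`, it follows that `p n ≤ 1 / 2 ^ (n - 1)`, and the welfare at this one profile already bounds the
worst case (`SybilProof.worstCaseWelfare_le`).

Attainment: under a uniformly random permutation a participant receives on average `1 / n` of the
cake, in the eyes of any nonzero valuation, reported or not. The coin turns this into `1 / 2 ^ (n -
1)`, so payoffs depend on the number of participants alone
(`IsPerfectPartitionLottery.payoff_eq_one_div`). Misreporting is then pointless, and `k ≥ 1`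
identities against `m` other participants earn `k / 2 ^ (k + m - 1) ≤ 1 / 2 ^ m`, because `k ≤ 2 ^
(k - 1)`.

Existence: perfect partitions come from Lyapunov's theorem, proved by showing that an extreme point
of a set of `[0, 1]`-valued functions with prescribed integrals is an indicator. Choosing the
partition from the set of reports, and permuting uniformly, makes the law symmetric. -/

noncomputable section
namespace CakeCutting
open scoped InnerProductSpace

/-! ### Extreme points in Hilbert space, and splitting sets under non-atomic measures -/

/-- A nonempty bounded closed convex set in a Hilbert space has an extreme point. -/
theorem extremePoints_nonempty_of_isClosed_of_isBounded {H : Type*} [NormedAddCommGroup H]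
    [InnerProductSpace ℝ H] [CompleteSpace H] {K : Set H} (hconv : Convex ℝ K)
    (hclosed : IsClosed K) (hbdd : Bornology.IsBounded K) (hne : K.Nonempty) :
    (K.extremePoints ℝ).Nonempty := by
  let T : H ≃ₗᵢ⋆[ℝ] StrongDual ℝ H := InnerProductSpace.toDual ℝ H
  have hT : ∀ g x, T g x = ⟪g, x⟫_ℝ := fun g x => InnerProductSpace.toDual_apply_apply
  -- The image of `K` under the Riesz isomorphism, written as an intersection of weak-* closed
  -- half-spaces. Hahn–Banach shows that nothing is added; Banach–Alaoglu then gives compactness and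
  -- Krein–Milman an extreme point.
  let K' : Set (WeakDual ℝ H) :=
    {φ | ∀ (x : H) (c : ℝ), (∀ k ∈ K, ⟪k, x⟫_ℝ ≤ c) → φ x ≤ c}
  have hmem : ∀ φ : WeakDual ℝ H, φ ∈ K' ↔ T.symm (WeakDual.toStrongDual φ) ∈ K := by
    intro φ
    have hφ : ∀ x, φ x = ⟪T.symm (WeakDual.toStrongDual φ), x⟫_ℝ := by
      intro x
      rw [← hT, LinearIsometryEquiv.apply_symm_apply]
      rfl
    constructor
    · intro h
      by_contra hg
      obtain ⟨l, u, hl, hu⟩ := geometric_hahn_banach_closed_point hconv hclosed hg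
      have hlx : ∀ k, l k = ⟪k, T.symm l⟫_ℝ := by
        intro k
        rw [real_inner_comm, ← hT, LinearIsometryEquiv.apply_symm_apply]
      have := h (T.symm l) u (fun k hk => by rw [← hlx]; exact (hl k hk).le)
      rw [hφ, ← hlx] at this
      linarith
    · intro h x c hc
      rw [hφ]
      exact hc _ h
  have hclosed' : IsClosed K' := by
    have : K' = ⋂ (x : H) (c : ℝ) (_ : ∀ k ∈ K, ⟪k, x⟫_ℝ ≤ c), {φ : WeakDual ℝ H | φ x ≤ c} := by
      ext φ
      simp [K']
    rw [this]
    refine isClosed_iInter fun x => isClosed_iInter fun c => isClosed_iInter fun _ => ?_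
    exact isClosed_le (WeakDual.eval_continuous x) continuous_const
  obtain ⟨M, hM⟩ := hbdd.exists_norm_le
  have hcompact : IsCompact K' := by
    refine (WeakDual.isCompact_closedBall (0 : StrongDual ℝ H) M).of_isClosed_subset hclosed' ?_
    intro φ hφ
    have := hM _ ((hmem φ).1 hφ)
    rw [LinearIsometryEquiv.norm_map] at this
    simpa using this
  have hne' : K'.Nonempty := by
    obtain ⟨k, hk⟩ := hne
    refine ⟨StrongDual.toWeakDual (T k), (hmem _).2 ?_⟩
    have : WeakDual.toStrongDual (StrongDual.toWeakDual (T k)) = T k := rfl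
    rw [this, LinearIsometryEquiv.symm_apply_apply]
    exact hk
  have : LocallyConvexSpace ℝ (WeakDual ℝ H) :=
    (WeakDual.withSeminorms ℝ H).toLocallyConvexSpace
  obtain ⟨φ, hφ, hext⟩ := hcompact.extremePoints_nonempty hne'
  refine ⟨T.symm (WeakDual.toStrongDual φ), (hmem φ).1 hφ, ?_⟩
  rintro x hx y hy ⟨a, b, ha, hb, hab, hxy⟩
  have hin : ∀ k ∈ K, StrongDual.toWeakDual (T k) ∈ K' := by
    intro k hk
    rw [hmem]
    have : WeakDual.toStrongDual (StrongDual.toWeakDual (T k)) = T k := rfl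
    rw [this, LinearIsometryEquiv.symm_apply_apply]
    exact hk
  have h1 := hext (hin x hx) (hin y hy) ⟨a, b, ha, hb, hab, by
    have : T (a • x + b • y) = WeakDual.toStrongDual φ := by
      rw [hxy, LinearIsometryEquiv.apply_symm_apply]
    rw [map_add, map_smulₛₗ, map_smulₛₗ] at this
    exact congrArg StrongDual.toWeakDual this⟩
  have h2 : T x = WeakDual.toStrongDual φ := congrArg WeakDual.toStrongDual h1
  rw [← h2, LinearIsometryEquiv.symm_apply_apply]

/-- A set of positive measure under a finite sum of non-atomic measures contains any finite number
of pairwise disjoint sets of positive measure. -/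
theorem exists_disjoint_subsets_of_nonatomic {C ι : Type*} [MeasurableSpace C] [Fintype ι]
    {μ : ι → Measure C} (hμ : ∀ i, Nonatomic (μ i)) (k : ℕ) {E : Set C} (hE : MeasurableSet E)
    (hpos : (∑ i, μ i) E ≠ 0) :
    ∃ A : Fin (k + 1) → Set C, (∀ j, MeasurableSet (A j)) ∧ (∀ j, A j ⊆ E) ∧
      (∀ j, (∑ i, μ i) (A j) ≠ 0) ∧ Pairwise fun j l => Disjoint (A j) (A l) := by
  have hle : ∀ i s, μ i s ≤ (∑ i, μ i) s := fun i s => by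
    rw [Measure.finsetSum_apply]
    exact Finset.single_le_sum (f := fun i => μ i s) (fun _ _ => bot_le) (Finset.mem_univ i)
  induction k generalizing E with
  | zero =>
    exact ⟨fun _ => E, fun _ => hE, fun _ => subset_rfl, fun _ => hpos,
      fun i j hij => (hij (Fin.ext (by lia))).elim⟩
  | succ k ih =>
    obtain ⟨i, hi⟩ : ∃ i, μ i E ≠ 0 := by
      by_contra! h
      exact hpos (by simp [Measure.finsetSum_apply, h])
    obtain ⟨t, htE, ht, h0, hlt⟩ := hμ i E hE (pos_iff_ne_zero.2 hi)
    have hdiff : μ i (E \ t) ≠ 0 := by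
      intro h
      have := measure_le_inter_add_sdiff (μ i) E t
      rw [h, add_zero, Set.inter_eq_right.2 htE] at this
      exact absurd hlt this.not_gt
    obtain ⟨A, hA, hAE, hApos, hdisj⟩ := ih (hE.diff ht)
      ((pos_iff_ne_zero.2 hdiff).trans_le (hle i _)).ne'
    refine ⟨Fin.cons t A, ?_, ?_, ?_, ?_⟩
    · exact Fin.cases ht hA
    · exact Fin.cases htE fun j => (hAE j).trans Set.sdiff_subset
    · exact Fin.cases (h0.trans_le (hle i _)).ne' hApos
    · have h0A : ∀ j, Disjoint t (A j) := fun j =>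
        (Set.disjoint_sdiff_right (s := t) (t := E)).mono_right (hAE j)
      intro a b
      refine Fin.cases ?_ (fun a => ?_) a <;> refine Fin.cases ?_ (fun b => ?_) b
      · intro h; exact (h rfl).elim
      · intro _; simpa using h0A b
      · intro _; simpa using (h0A a).symm
      · intro h
        simpa using hdisj (fun hab => h (congrArg Fin.succ hab))

end CakeCutting
end

/-! ### Lyapunov's theorem and equal partitions -/

noncomputable section
namespace CakeCutting
open scoped InnerProductSpace

/-- On a set of positive measure, finitely many non-atomic finite measures are simultaneously
annihilated by a nontrivial bounded function. -/
theorem exists_integral_eq_zero_of_nonatomic {C ι : Type*} [MeasurableSpace C] [Fintype ι]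
    {μ : ι → Measure C} [∀ i, IsFiniteMeasure (μ i)] (hμ : ∀ i, Nonatomic (μ i))
    {E : Set C} (hE : MeasurableSet E) (hpos : (∑ i, μ i) E ≠ 0) :
    ∃ h : C → ℝ, Measurable h ∧ (∀ x, |h x| ≤ 1) ∧ (∀ x, x ∉ E → h x = 0) ∧
      (∀ i, ∫ x, h x ∂μ i = 0) ∧ ¬ h =ᵐ[∑ i, μ i] 0 := by
  obtain ⟨A, hA, hAE, hApos, hdisj⟩ :=
    exists_disjoint_subsets_of_nonatomic hμ (Fintype.card ι) hE hpos
  let F : (Fin (Fintype.card ι + 1) → ℝ) →ₗ[ℝ] (ι → ℝ) :=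
    LinearMap.pi fun i => ∑ j, (μ i).real (A j) • LinearMap.proj j
  -- There is one more coefficient than there are equations, so some nonzero step function on the
  -- sets `A j` integrates to zero against every `μ i`.
  have hF : LinearMap.ker F ≠ ⊥ := LinearMap.ker_ne_bot_of_finrank_lt (by simp)
  obtain ⟨a, ha, ha0⟩ := (Submodule.ne_bot_iff _).1 hF
  obtain ⟨j₀, hj₀⟩ : ∃ j, a j ≠ 0 := by
    by_contra! h
    exact ha0 (funext h)
  have hB : 0 < ∑ j, |a j| :=
    (abs_pos.2 hj₀).trans_le
      (Finset.single_le_sum (f := fun j => |a j|) (fun _ _ => abs_nonneg _) (Finset.mem_univ j₀))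
  set B := ∑ j, |a j| with hBdef
  have hval : ∀ i, ∑ j, a j * (μ i).real (A j) = 0 := by
    intro i
    have := congrFun (LinearMap.mem_ker.1 ha) i
    simpa [F, mul_comm] using this
  let f : C → ℝ := fun x => ∑ j, a j * (A j).indicator (fun _ => (1 : ℝ)) x
  have hfm : Measurable f := by
    refine Finset.measurable_sum _ fun j _ => ?_
    exact (measurable_const.indicator (hA j)).const_mul _
  have hfA : ∀ x ∈ A j₀, f x = a j₀ := by
    intro x hx
    have : f x = a j₀ * (A j₀).indicator (fun _ => (1 : ℝ)) x := by
      refine Finset.sum_eq_single j₀ (fun j _ hj => ?_) (by simp)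
      have : x ∉ A j := fun hxj => Set.disjoint_left.1 (hdisj hj) hxj hx
      simp [this]
    rw [this, Set.indicator_of_mem hx, mul_one]
  refine ⟨fun x => B⁻¹ * f x, hfm.const_mul _, ?_, ?_, ?_, ?_⟩
  · intro x
    have : |f x| ≤ B := by
      refine (Finset.abs_sum_le_sum_abs _ _).trans (Finset.sum_le_sum fun j _ => ?_)
      rw [abs_mul]
      refine mul_le_of_le_one_right (abs_nonneg _) ?_
      by_cases hx : x ∈ A j <;> simp [hx]
    rw [abs_mul, abs_of_pos (inv_pos.2 hB), inv_mul_le_iff₀ hB, mul_one]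
    exact this
  · intro x hx
    have : ∀ j, x ∉ A j := fun j h => hx (hAE j h)
    simp [f, this]
  · intro i
    rw [integral_const_mul, integral_finsetSum]
    · have : ∀ j, ∫ x, a j * (A j).indicator (fun _ => (1 : ℝ)) x ∂μ i
          = a j * (μ i).real (A j) := by
        intro j
        rw [integral_const_mul, integral_indicator_const _ (hA j), smul_eq_mul, mul_one]
      simp_rw [this, hval i, mul_zero]
    · intro j _
      exact ((integrable_const (1 : ℝ)).indicator (hA j)).const_mul _
  · intro h0
    refine hApos j₀ (measure_mono_null (fun x hx => ?_) (ae_iff.1 h0))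
    simp [hfA x hx, hj₀, hB.ne']

/-- **Lyapunov's theorem**, for the segment from the zero vector to the vector of total masses:
finitely many non-atomic finite measures have a common set that takes a given fraction of each. -/
theorem exists_measureReal_eq_mul_of_nonatomic {C ι : Type*} [MeasurableSpace C] [Fintype ι]
    {μ : ι → Measure C} [∀ i, IsFiniteMeasure (μ i)] (hμ : ∀ i, Nonatomic (μ i))
    {c : ℝ} (hc0 : 0 ≤ c) (hc1 : c ≤ 1) :
    ∃ A, MeasurableSet A ∧ ∀ i, (μ i).real A = c * (μ i).real Set.univ := by
  set ν : Measure C := ∑ i, μ i with hν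
  have hle : ∀ i, μ i ≤ ν := fun i => Measure.le_iff.2 fun s _ => by
    rw [hν, Measure.finsetSum_apply]
    exact Finset.single_le_sum (f := fun i => μ i s) (fun _ _ => bot_le) (Finset.mem_univ i)
  have hac : ∀ i, μ i ≪ ν := fun i => (hle i).absolutelyContinuous
  have hrm : ∀ i, MemLp (fun x => ((μ i).rnDeriv ν x).toReal) 2 ν := by
    intro i
    refine MemLp.of_bound ((μ i).measurable_rnDeriv ν).ennreal_toReal.aestronglyMeasurable 1 ?_
    filter_upwards [Measure.rnDeriv_le_one_of_le (hle i)] with x hx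
    rw [Real.norm_of_nonneg ENNReal.toReal_nonneg]
    exact ENNReal.toReal_le_of_le_ofReal zero_le_one (by simpa using hx)
  let r : ι → Lp ℝ 2 ν := fun i => (hrm i).toLp
  have hr : ∀ (g : Lp ℝ 2 ν) i, ⟪g, r i⟫_ℝ = ∫ x, g x ∂μ i := by
    intro g i
    rw [L2.inner_def, ← integral_rnDeriv_smul (hac i)]
    refine integral_congr_ae ?_
    filter_upwards [(hrm i).coeFn_toLp] with x hx
    simp [r, hx]
  let one : Lp ℝ 2 ν := Lp.const 2 ν (1 : ℝ)
  have hone : one =ᵐ[ν] fun _ => (1 : ℝ) := Lp.coeFn_const ..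
  -- The relaxed problem: "fuzzy sets" with values in `[0, 1]` and the prescribed masses. The
  -- constant `c` is a member, and an extreme point will turn out to be a genuine set. The masses
  -- are inner products with the densities `r i`, hence continuous on `L²`.
  let K : Set (Lp ℝ 2 ν) := Set.Icc 0 one ∩ {g | ∀ i, ⟪g, r i⟫_ℝ = c * (μ i).real Set.univ}
  have hK : ∀ g : Lp ℝ 2 ν, g ∈ K ↔ (∀ᵐ x ∂ν, 0 ≤ g x ∧ g x ≤ 1) ∧
      ∀ i, ∫ x, g x ∂μ i = c * (μ i).real Set.univ := by
    intro g
    have h1 : 0 ≤ g ↔ ∀ᵐ x ∂ν, 0 ≤ g x := (Lp.coeFn_nonneg g).symm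
    have h2 : g ≤ one ↔ ∀ᵐ x ∂ν, g x ≤ 1 := by
      rw [← Lp.coeFn_le]
      constructor
      · intro h; filter_upwards [h, hone] with x hx h1; rwa [h1] at hx
      · intro h; filter_upwards [h, hone] with x hx h1; rwa [h1]
    simp only [K, Set.mem_inter_iff, Set.mem_Icc, h1, h2, Set.mem_ofPred_eq, hr,
      Filter.eventually_and]
  have hconv : Convex ℝ K := by
    intro f hf g hg a b ha hb hab
    rw [hK] at hf hg
    have hcoe : ∀ᵐ x ∂ν, (a • f + b • g : Lp ℝ 2 ν) x = a * f x + b * g x := by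
      filter_upwards [Lp.coeFn_add (a • f) (b • g), Lp.coeFn_smul a f, Lp.coeFn_smul b g]
        with x h1 h2 h3
      rw [h1, Pi.add_apply, h2, h3, Pi.smul_apply, Pi.smul_apply, smul_eq_mul, smul_eq_mul]
    refine (hK _).2 ⟨?_, fun i => ?_⟩
    · filter_upwards [hf.1, hg.1, hcoe] with x h1 h2 h3
      rw [h3]
      exact convex_Icc (0 : ℝ) 1 h1 h2 ha hb hab
    · rw [← hr, inner_add_left, real_inner_smul_left, real_inner_smul_left, hr, hr, hf.2, hg.2,
        ← add_mul, hab, one_mul]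
  have hclosed : IsClosed K := by
    refine isClosed_Icc.inter ?_
    rw [Set.ofPred_forall]
    exact isClosed_iInter fun i => isClosed_eq (continuous_id.inner continuous_const)
      continuous_const
  have hbdd : Bornology.IsBounded K := by
    refine isBounded_iff_forall_norm_le.2 ⟨‖one‖, fun g hg => norm_le_norm_of_abs_le_abs ?_⟩
    have h0 := hg.1.1
    rw [abs_of_nonneg h0, abs_of_nonneg (h0.trans hg.1.2)]
    exact hg.1.2
  have hne : K.Nonempty := by
    refine ⟨Lp.const 2 ν c, (hK _).2 ?_⟩
    have hcst : (Lp.const 2 ν c : Lp ℝ 2 ν) =ᵐ[ν] fun _ => c := Lp.coeFn_const ..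
    refine ⟨?_, fun i => ?_⟩
    · filter_upwards [hcst] with x hx
      rw [hx]
      exact ⟨hc0, hc1⟩
    · rw [integral_congr_ae ((hac i).ae_eq hcst)]
      simp [mul_comm]
  obtain ⟨g, hgK, hext⟩ :=
    extremePoints_nonempty_of_isClosed_of_isBounded hconv hclosed hbdd hne
  have hg := (hK g).1 hgK
  have hgm : Measurable g := (Lp.stronglyMeasurable g).measurable
  -- Where `g` stays `ε` away from `0` and `1` there is room to add `±ε h` with `h` annihilated by
  -- all `μ i`; if this region had positive mass, `g` would be the midpoint of two other members of
  -- `K`.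
  have hnull : ∀ ε : ℝ, 0 < ε → ν {x | ε ≤ g x ∧ g x ≤ 1 - ε} = 0 := by
    intro ε hε
    by_contra hpos
    obtain ⟨h, hhm, hh1, hhE, hhi, hh0⟩ := exists_integral_eq_zero_of_nonatomic hμ
      ((measurableSet_le measurable_const hgm).inter (measurableSet_le hgm measurable_const)) hpos
    have hhL : MemLp h 2 ν :=
      MemLp.of_bound hhm.aestronglyMeasurable 1 (Filter.Eventually.of_forall hh1)
    have hcoe : hhL.toLp =ᵐ[ν] h := hhL.coeFn_toLp
    have hmem : ∀ δ : ℝ, |δ| ≤ ε → g + δ • hhL.toLp ∈ K := by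
      intro δ hδ
      have hadd : ∀ᵐ x ∂ν, (g + δ • hhL.toLp : Lp ℝ 2 ν) x = g x + δ * h x := by
        filter_upwards [Lp.coeFn_add g (δ • hhL.toLp), Lp.coeFn_smul δ hhL.toLp, hcoe]
          with x h1 h2 h3
        rw [h1, Pi.add_apply, h2, Pi.smul_apply, h3, smul_eq_mul]
      refine (hK _).2 ⟨?_, fun i => ?_⟩
      · filter_upwards [hadd, hg.1] with x hx hgx
        rw [hx]
        by_cases hxE : ε ≤ g x ∧ g x ≤ 1 - ε
        · have : |δ * h x| ≤ ε := by
            rw [abs_mul]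
            exact (mul_le_of_le_one_right (abs_nonneg _) (hh1 x)).trans hδ
          rw [abs_le] at this
          constructor <;> linarith [hxE.1, hxE.2]
        · rw [hhE x hxE, mul_zero, add_zero]
          exact hgx
      · rw [← hr, inner_add_left, real_inner_smul_left, hr, hr, hg.2,
          integral_congr_ae ((hac i).ae_eq hcoe), hhi, mul_zero, add_zero]
    have habs : |ε| ≤ ε := (abs_of_pos hε).le
    have := hext (hmem ε habs) (hmem (-ε) (by rwa [abs_neg]))
      ⟨1 / 2, 1 / 2, by norm_num, by norm_num, by norm_num, by module⟩
    rw [add_eq_left, smul_eq_zero_iff_right hε.ne'] at this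
    rw [this] at hcoe
    exact hh0 (hcoe.symm.trans (Lp.coeFn_zero ..))
  have h01 : ∀ᵐ x ∂ν, g x = 0 ∨ g x = 1 := by
    have hall : ∀ᵐ x ∂ν, ∀ n : ℕ, ¬ (1 / ((n : ℝ) + 1) ≤ g x ∧ g x ≤ 1 - 1 / ((n : ℝ) + 1)) := by
      rw [ae_all_iff]
      intro n
      rw [ae_iff]
      simpa only [not_not] using hnull _ Nat.one_div_pos_of_nat
    filter_upwards [hall, hg.1] with x hx hgx
    by_contra! hne
    have h0 : 0 < min (g x) (1 - g x) :=
      lt_min (lt_of_le_of_ne hgx.1 hne.1.symm) (sub_pos.2 (lt_of_le_of_ne hgx.2 hne.2))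
    obtain ⟨n, hn⟩ := exists_nat_one_div_lt h0
    have := lt_min_iff.1 hn
    exact hx n ⟨this.1.le, by linarith [this.2]⟩
  have hA : MeasurableSet {x | g x = 1} := hgm (measurableSet_singleton 1)
  refine ⟨{x | g x = 1}, hA, fun i => ?_⟩
  rw [← hg.2 i, ← integral_indicator_one hA]
  refine integral_congr_ae ((hac i).ae_le ?_)
  filter_upwards [h01] with x hx
  rcases hx with hx | hx <;> simp [Set.indicator, hx]

/-- Finitely many non-atomic finite measures have a common partition into `k + 1` sets of equal
value. -/
theorem exists_partition_measureReal_eq_div {C ι : Type*} [MeasurableSpace C] [Fintype ι]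
    (k : ℕ) {μ : ι → Measure C} [∀ i, IsFiniteMeasure (μ i)] (hμ : ∀ i, Nonatomic (μ i)) :
    ∃ D : Fin (k + 1) → Set C, (∀ j, MeasurableSet (D j)) ∧
      (Pairwise fun j l => Disjoint (D j) (D l)) ∧ ⋃ j, D j = Set.univ ∧
      ∀ i j, (μ i).real (D j) = (μ i).real Set.univ / ((k : ℝ) + 1) := by
  induction k generalizing μ with
  | zero =>
    exact ⟨fun _ => Set.univ, fun _ => .univ, fun i j hij => (hij (Fin.ext (by lia))).elim,
      Set.iUnion_const _, by simp⟩
  | succ k ih =>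
    have hk : (0 : ℝ) < (k : ℝ) + 1 := by positivity
    -- Cut off one of `k + 2` equal shares; the rest is divided by induction, applied to the
    -- restrictions to `Aᶜ`, which are again non-atomic.
    obtain ⟨A, hA, hAμ⟩ := exists_measureReal_eq_mul_of_nonatomic hμ (c := 1 / ((k : ℝ) + 1 + 1))
      (by positivity) (by rw [div_le_one (by positivity)]; linarith)
    obtain ⟨D, hD, hdisj, hcover, hDμ⟩ := ih (μ := fun i => (μ i).restrict Aᶜ) (by
      intro i s hs hpos
      rw [Measure.restrict_apply hs] at hpos
      obtain ⟨t, hts, ht, h0, hlt⟩ := hμ i _ (hs.inter hA.compl) hpos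
      refine ⟨t, hts.trans Set.inter_subset_left, ht, ?_⟩
      rw [Measure.restrict_apply hs, Measure.restrict_apply ht,
        Set.inter_eq_left.2 (hts.trans Set.inter_subset_right)]
      exact ⟨h0, hlt⟩)
    refine ⟨Fin.cons A fun j => D j ∩ Aᶜ, ?_, ?_, ?_, ?_⟩
    · exact Fin.cases hA fun j => (hD j).inter hA.compl
    · have h0A : ∀ j, Disjoint A (D j ∩ Aᶜ) := fun j =>
        disjoint_compl_right.mono_right Set.inter_subset_right
      intro a b
      refine Fin.cases ?_ (fun a => ?_) a <;> refine Fin.cases ?_ (fun b => ?_) b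
      · intro h; exact (h rfl).elim
      · intro _; simpa using h0A b
      · intro _; simpa using (h0A a).symm
      · intro h
        have := hdisj (i := a) (j := b) (fun hab => h (congrArg Fin.succ hab))
        simpa using (this.mono Set.inter_subset_left Set.inter_subset_left)
    · rw [Set.eq_univ_iff_forall]
      intro x
      by_cases hx : x ∈ A
      · exact Set.mem_iUnion.2 ⟨0, hx⟩
      · obtain ⟨j, hj⟩ := Set.mem_iUnion.1 (Set.eq_univ_iff_forall.1 hcover x)
        exact Set.mem_iUnion.2 ⟨j.succ, hj, hx⟩
    · intro i
      refine Fin.cases ?_ fun j => ?_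
      · rw [Fin.cons_zero, hAμ]
        push_cast
        ring
      · have h1 := hDμ i j
        rw [measureReal_restrict_apply (hD j), measureReal_restrict_apply .univ, Set.univ_inter,
          measureReal_compl hA, hAμ] at h1
        rw [Fin.cons_succ, h1]
        push_cast
        field_simp
        ring

end CakeCutting
end

/-! ### Payoffs and the upper bound for Sybil-proof mechanisms -/

noncomputable section
namespace CakeCutting

namespace Valuation

variable {C : Type u} [MeasurableSpace C]

theorem measurable_value (μ : Valuation C) : Measurable μ.value :=
  (comap_measurable μ.value).mono
    (le_iSup (fun μ : Valuation C => MeasurableSpace.comap μ.value inferInstance) μ) le_rfl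

theorem isProbabilityMeasure {μ : Valuation C} (hμ : μ ≠ 0) : IsProbabilityMeasure μ.1 :=
  (μ.2.resolve_left fun h => hμ (Subtype.ext h)).1

theorem nonatomic {μ : Valuation C} (hμ : μ ≠ 0) : Nonatomic μ.1 :=
  (μ.2.resolve_left fun h => hμ (Subtype.ext h)).2

instance (μ : Valuation C) : IsZeroOrProbabilityMeasure μ.1 := by
  rcases eq_or_ne μ 0 with rfl | h
  · exact inferInstanceAs (IsZeroOrProbabilityMeasure (0 : Measure C))
  · have := isProbabilityMeasure h
    infer_instance

theorem value_nonneg (μ : Valuation C) (s : Slice C) : 0 ≤ μ.value s := measureReal_nonneg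

theorem value_le_one (μ : Valuation C) (s : Slice C) : μ.value s ≤ 1 := measureReal_le_one

@[simp]
theorem zero_value (s : Slice C) : (0 : Valuation C).value s = 0 :=
  show (0 : Measure C).real s.1 = 0 by simp

theorem value_of_eq_empty (μ : Valuation C) {s : Slice C} (hs : s.1 = ∅) : μ.value s = 0 := by
  rw [value, hs, measureReal_empty]

end Valuation

namespace Mechanism

variable {C : Type u} [MeasurableSpace C]

attribute [local instance] Mechanism.mΩ Mechanism.prob

theorem payoff_nonneg (A : Mechanism.{u, w} C) (μ : Valuation C) (v : Profile C) (i : ℕ) :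
    0 ≤ A.payoff μ v i :=
  integral_nonneg fun _ => μ.value_nonneg _

theorem payoff_le_one (A : Mechanism.{u, w} C) (μ : Valuation C) (v : Profile C) (i : ℕ) :
    A.payoff μ v i ≤ 1 := by
  have h := integral_mono_of_nonneg (μ := A.P)
    (Filter.Eventually.of_forall fun ω => μ.value_nonneg (A.alloc v ω i))
    (integrable_const (1 : ℝ)) (Filter.Eventually.of_forall fun ω => μ.value_le_one (A.alloc v ω i))
  simpa [payoff] using h

theorem payoff_of_inactive (A : Mechanism.{u, w} C) (μ : Valuation C) {v : Profile C} {i : ℕ}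
    (h : v i = 0) : A.payoff μ v i = 0 := by
  simp [payoff, μ.value_of_eq_empty (A.alloc_inactive v _ i h)]

@[simp]
theorem payoff_zero (A : Mechanism.{u, w} C) (v : Profile C) (i : ℕ) : A.payoff 0 v i = 0 := by
  simp [payoff]

/-- Renaming the identities does not change the payoffs. -/
theorem payoff_equivMapDomain (A : Mechanism.{u, w} C) (μ : Valuation C) (v : Profile C)
    (σ : Equiv.Perm ℕ) (i : ℕ) :
    A.payoff μ (Finsupp.equivMapDomain σ v) (σ i) = A.payoff μ v i := by
  have hf : Measurable fun x : ℕ → Slice C => μ.value (x i) :=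
    μ.measurable_value.comp (measurable_pi_apply i)
  have hσ : Measurable fun ω j => A.alloc (Finsupp.equivMapDomain σ v) ω (σ j) :=
    measurable_pi_lambda _ fun j =>
      (measurable_pi_apply (σ j)).comp (A.measurable_alloc (Finsupp.equivMapDomain σ v))
  have h := congrArg (fun m : Measure (ℕ → Slice C) => ∫ x, μ.value (x i) ∂m) (A.symmetric v σ)
  rw [integral_map (A.measurable_alloc v).aemeasurable hf.aestronglyMeasurable,
    integral_map hσ.aemeasurable hf.aestronglyMeasurable] at h
  exact h.symm

/-- The profile in which the first `n` identities report `μ`. -/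
def constProfile (μ : Valuation C) (n : ℕ) : Profile C :=
  Finsupp.embDomain Fin.valEmbedding (Finsupp.equivFunOnFinite.symm fun _ : Fin n => μ)

theorem constProfile_apply (μ : Valuation C) (n j : ℕ) :
    constProfile μ n j = if j < n then μ else 0 := by
  split_ifs with h
  · exact Finsupp.embDomain_apply_self Fin.valEmbedding _ (⟨j, h⟩ : Fin n)
  · refine Finsupp.embDomain_of_notMem_range _ _ _ ?_
    rintro ⟨k, rfl⟩
    exact h k.2

/-- Swapping two identities with the same report leaves the profile unchanged, so symmetry equates
their payoffs. -/
theorem payoff_constProfile_eq (A : Mechanism.{u, w} C) (μ : Valuation C) {n i : ℕ} (hi : i < n) :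
    A.payoff μ (constProfile μ n) i = A.payoff μ (constProfile μ n) 0 := by
  have h : Finsupp.equivMapDomain (Equiv.swap 0 i) (constProfile μ n) = constProfile μ n := by
    ext1 j
    rw [Finsupp.equivMapDomain_apply, constProfile_apply, constProfile_apply, Equiv.symm_swap]
    rcases eq_or_ne j 0 with rfl | h0
    · rw [Equiv.swap_apply_left, if_pos hi, if_pos (by lia)]
    rcases eq_or_ne j i with rfl | h1
    · rw [Equiv.swap_apply_right, if_pos hi, if_pos (by lia)]
    rw [Equiv.swap_apply_of_ne_of_ne h0 h1]
  have := A.payoff_equivMapDomain μ (constProfile μ n) (Equiv.swap 0 i) 0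
  rwa [h, Equiv.swap_apply_left] at this

/-- The attack by one clone: identity `0` also controls the free identity `n` and reports `μ` under
both, collecting two equal payoffs. -/
theorem SybilProof.two_mul_payoff_constProfile_le {A : Mechanism.{u, w} C} (hA : A.SybilProof)
    (μ : Valuation C) {n : ℕ} (hn : 1 ≤ n) :
    2 * A.payoff μ (constProfile μ (n + 1)) 0 ≤ A.payoff μ (constProfile μ n) 0 := by
  have h := hA (constProfile μ n) (constProfile μ (n + 1)) 0 {0, n} (by simp)
    (by
      intro j hj hj0
      rw [Finset.mem_insert, Finset.mem_singleton] at hj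
      rw [constProfile_apply, if_neg (by lia)])
    (by
      intro j hj
      rw [Finset.mem_insert, Finset.mem_singleton] at hj
      simp only [constProfile_apply]
      exact if_congr (by lia) rfl rfl)
  rw [constProfile_apply, if_pos (by lia), Finset.sum_pair (by lia),
    A.payoff_constProfile_eq μ (Nat.lt_succ_self n)] at h
  linarith

theorem SybilProof.payoff_constProfile_le {A : Mechanism.{u, w} C} (hA : A.SybilProof)
    (μ : Valuation C) (n : ℕ) :
    A.payoff μ (constProfile μ (n + 1)) 0 ≤ 1 / 2 ^ n := by
  induction n with
  | zero => simpa using A.payoff_le_one μ _ 0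
  | succ n ih =>
    have := hA.two_mul_payoff_constProfile_le μ (Nat.succ_pos n)
    rw [pow_succ, ← div_div]
    linarith

theorem SybilProof.worstCaseWelfare_le {A : Mechanism.{u, w} C} (hA : A.SybilProof)
    {μ : Valuation C} (hμ : μ ≠ 0) {n : ℕ} (hn : 1 ≤ n) :
    A.worstCaseWelfare n ≤ (n : ℝ) / 2 ^ (n - 1) := by
  -- A real infimum is bounded by its members only if the family is bounded below.
  have hbdd : BddBelow (Set.range (A.welfare n)) := by
    refine ⟨0, ?_⟩
    rintro _ ⟨ν, rfl⟩
    exact Finset.sum_nonneg fun i _ => A.payoff_nonneg _ _ _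
  refine (ciInf_le hbdd fun _ => ⟨μ, hμ⟩).trans ?_
  obtain ⟨m, rfl⟩ := Nat.exists_eq_add_of_le' hn
  have h : ∀ i : Fin (m + 1), A.payoff μ (constProfile μ (m + 1)) i ≤ 1 / 2 ^ m := fun i =>
    (A.payoff_constProfile_eq μ i.2).trans_le (hA.payoff_constProfile_le μ m)
  refine (Finset.sum_le_sum fun i _ => h i).trans_eq ?_
  simp [div_eq_mul_inv]

end Mechanism

/-! ### Payoffs and incentives in a perfect-partition lottery -/

/-- A uniform permutation sends `i` to a uniform element: right multiplication by a swap shows that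
the sum over `τ` is the same for all starting points, and summing over these gives every `f j` once
per permutation. -/
theorem card_mul_sum_perm_apply {α : Type*} [Fintype α] [DecidableEq α] (f : α → ℝ) (i : α) :
    (Fintype.card α : ℝ) * ∑ τ : Equiv.Perm α, f (τ i) =
      ((Fintype.card α).factorial : ℝ) * ∑ j, f j := by
  have h : ∀ k, ∑ τ : Equiv.Perm α, f (τ k) = ∑ τ : Equiv.Perm α, f (τ i) := fun k =>
    Fintype.sum_equiv (Equiv.mulRight (Equiv.swap i k)) _ _ fun τ => by simp
  calc (Fintype.card α : ℝ) * ∑ τ : Equiv.Perm α, f (τ i)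
      = ∑ k, ∑ τ : Equiv.Perm α, f (τ k) := by simp [h]
    _ = ∑ τ : Equiv.Perm α, ∑ k, f (τ k) := Finset.sum_comm
    _ = ∑ _τ : Equiv.Perm α, ∑ j, f j := Finset.sum_congr rfl fun τ _ => Equiv.sum_comp τ f
    _ = _ := by simp [Fintype.card_perm]

theorem IsPerfectPartition.sum_value {C : Type u} [MeasurableSpace C] {v : Profile C}
    {D : v.support → Slice C} (hD : IsPerfectPartition v D) (μ : Valuation C) :
    ∑ j, μ.value (D j) = μ.1.real Set.univ := by
  rw [← hD.cover, measureReal_iUnion_fintype (fun i j => hD.disjoint i j) fun j => (D j).2]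
  rfl

namespace Mechanism

variable {C : Type u} [MeasurableSpace C]

attribute [local instance] Mechanism.mΩ Mechanism.prob

/-- In a perfect-partition lottery the payoff of a participant depends on the number of
participants only. -/
theorem IsPerfectPartitionLottery.payoff_eq {A : Mechanism.{u, w} C}
    (hA : A.IsPerfectPartitionLottery) (μ : Valuation C) {v : Profile C} {i : ℕ} (hi : v i ≠ 0) :
    A.payoff μ v i = μ.1.real Set.univ / 2 ^ (v.support.card - 1) := by
  obtain ⟨D, σ, X, hD, hσ, hX, hσP, hXP, hind, halloc⟩ := hA v (by rintro rfl; exact hi rfl)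
  let i' : v.support := ⟨i, Finsupp.mem_support_iff.2 hi⟩
  have hcard : (v.support.card : ℝ) ≠ 0 :=
    Nat.cast_ne_zero.2 (Finset.card_ne_zero_of_mem i'.2)
  -- Splitting by the outcome of the permutation reduces the integral to the finitely many
  -- probabilities `hP`, where independence of the coin enters.
  have hval : ∀ ω, μ.value (A.alloc v ω i) = ∑ τ : Equiv.Perm v.support,
      ({ω | σ ω = τ} ∩ {ω | X ω = true}).indicator (fun _ => μ.value (D (τ i'))) ω := by
    intro ω
    have h := halloc ω i'
    by_cases hXω : X ω = true
    · rw [if_pos hXω] at h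
      rw [Finset.sum_eq_single (σ ω)]
      · have hm : ω ∈ {ω' | σ ω' = σ ω} ∩ {ω' | X ω' = true} := ⟨rfl, hXω⟩
        rw [Set.indicator_of_mem hm]
        exact congrArg μ.1.real h
      · intro τ _ hτ
        exact Set.indicator_of_notMem (fun hm => hτ hm.1.symm) _
      · simp
    · rw [if_neg hXω] at h
      rw [μ.value_of_eq_empty h, Finset.sum_eq_zero]
      intro τ _
      exact Set.indicator_of_notMem (fun hm => hXω hm.2) _
  have hP : ∀ τ, A.P.real ({ω | σ ω = τ} ∩ {ω | X ω = true}) =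
      1 / (v.support.card.factorial : ℝ) * (v.support.card / 2 ^ (v.support.card - 1)) := by
    intro τ
    rw [← hσP τ, ← hXP, Measure.real, (hind τ).measure_inter_eq_mul, ENNReal.toReal_mul]
    rfl
  have hsum := card_mul_sum_perm_apply (fun j => μ.value (D j)) i'
  rw [hD.sum_value, Fintype.card_coe] at hsum
  have hfac : (v.support.card.factorial : ℝ) ≠ 0 := Nat.cast_ne_zero.2 (Nat.factorial_ne_zero _)
  have hm : ∀ τ, MeasurableSet ({ω | σ ω = τ} ∩ {ω | X ω = true}) := fun τ => (hσ τ).inter hX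
  calc A.payoff μ v i
      = ∫ ω, ∑ τ : Equiv.Perm v.support,
          ({ω | σ ω = τ} ∩ {ω | X ω = true}).indicator (fun _ => μ.value (D (τ i'))) ω ∂A.P :=
        integral_congr_ae (Filter.Eventually.of_forall hval)
    _ = ∑ τ : Equiv.Perm v.support, 1 / (v.support.card.factorial : ℝ) *
          (v.support.card / 2 ^ (v.support.card - 1)) * μ.value (D (τ i')) := by
        rw [integral_finsetSum _ fun τ _ => (integrable_const _).indicator (hm τ)]
        refine Finset.sum_congr rfl fun τ _ => ?_
        rw [integral_indicator_const _ (hm τ), hP, smul_eq_mul]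
    _ = 1 / (v.support.card.factorial : ℝ) / 2 ^ (v.support.card - 1) *
          (v.support.card * ∑ τ : Equiv.Perm v.support, μ.value (D (τ i'))) := by
        rw [← Finset.mul_sum]
        ring
    _ = _ := by
        rw [hsum]
        field_simp

theorem IsPerfectPartitionLottery.payoff_eq_one_div {A : Mechanism.{u, w} C}
    (hA : A.IsPerfectPartitionLottery) {μ : Valuation C} (hμ : μ ≠ 0) {v : Profile C} {i : ℕ}
    (hi : v i ≠ 0) : A.payoff μ v i = 1 / 2 ^ (v.support.card - 1) := by
  have := Valuation.isProbabilityMeasure hμ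
  rw [hA.payoff_eq μ hi, probReal_univ]

theorem IsPerfectPartitionLottery.proportionalInExpectation {A : Mechanism.{u, w} C}
    (hA : A.IsPerfectPartitionLottery) :
    A.ProportionalInExpectation fun n => 1 / 2 ^ (n - 1) :=
  fun _ _ hi => (hA.payoff_eq_one_div hi hi).ge

theorem IsPerfectPartitionLottery.truthful {A : Mechanism.{u, w} C}
    (hA : A.IsPerfectPartitionLottery) : A.Truthful := by
  intro v i μ ν
  rcases eq_or_ne μ 0 with rfl | hμ
  · simp
  rcases eq_or_ne ν 0 with rfl | hν
  · rw [A.payoff_of_inactive μ (by simp)]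
    exact A.payoff_nonneg _ _ _
  · rw [hA.payoff_eq_one_div hμ (by simpa using hν), hA.payoff_eq_one_div hμ (by simpa using hμ),
      Finsupp.support_update_ne_zero _ _ hμ, Finsupp.support_update_ne_zero _ _ hν]

/-- Only head counts matter: with `m` participants outside `S` and `k` active identities inside, the
claim is `k / 2 ^ (k + m - 1) ≤ 1 / 2 ^ m`. -/
theorem IsPerfectPartitionLottery.sybilProof {A : Mechanism.{u, w} C}
    (hA : A.IsPerfectPartitionLottery) : A.SybilProof := by
  intro v u i S hiS hv hu
  rcases eq_or_ne (v i) 0 with hi | hi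
  · simp [hi]
  have hvs : v.support = insert i (v.support \ S) := by
    ext j
    simp only [Finset.mem_insert, Finset.mem_sdiff, Finsupp.mem_support_iff]
    constructor
    · intro hj
      by_contra! h
      exact hj (hv j (h.2 hj) h.1)
    · rintro (rfl | h)
      exacts [hi, h.1]
  have hus : u.support = (u.support ∩ S) ∪ (v.support \ S) := by
    ext j
    simp only [Finset.mem_union, Finset.mem_inter, Finset.mem_sdiff, Finsupp.mem_support_iff]
    by_cases hj : j ∈ S
    · simp [hj]
    · simp [hj, hu j hj]
  have hdisj : Disjoint (u.support ∩ S) (v.support \ S) :=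
    Finset.disjoint_sdiff.mono_left Finset.inter_subset_right
  have hvc := congrArg Finset.card hvs
  rw [Finset.card_insert_of_notMem (by simp [hiS])] at hvc
  have huc := congrArg Finset.card hus
  rw [Finset.card_union_of_disjoint hdisj] at huc
  have hsum : ∑ j ∈ S, A.payoff (v i) u j =
      (u.support ∩ S).card * (1 / 2 ^ (u.support.card - 1)) := by
    rw [← Finset.sum_subset Finset.inter_subset_right, Finset.sum_congr rfl
      (g := fun _ => (1 / 2 ^ (u.support.card - 1) : ℝ)), Finset.sum_const, nsmul_eq_mul]
    · intro j hj
      exact hA.payoff_eq_one_div hi (Finsupp.mem_support_iff.1 (Finset.mem_inter.1 hj).1)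
    · intro j hjS hj
      refine A.payoff_of_inactive _ ?_
      by_contra h
      exact hj (Finset.mem_inter.2 ⟨Finsupp.mem_support_iff.2 h, hjS⟩)
  rw [hsum, hA.payoff_eq_one_div hi hi, huc, hvc, Nat.add_sub_cancel]
  generalize (u.support ∩ S).card = k
  generalize (v.support \ S).card = m
  -- With no active identity the player gets nothing; otherwise `k` is shifted by one, which removes
  -- the truncated subtraction and leaves `k + 1 ≤ 2 ^ k`.
  rcases k with _ | k
  · simp
  have hk : ((k + 1 : ℕ) : ℝ) ≤ 2 ^ k := by exact_mod_cast Nat.lt_two_pow_self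
  rw [show k + 1 + m - 1 = k + m by lia, pow_add, mul_one_div,
    div_le_div_iff₀ (by positivity) (by positivity)]
  have : (0 : ℝ) ≤ 2 ^ m := by positivity
  nlinarith

theorem IsPerfectPartitionLottery.welfare_eq {A : Mechanism.{u, w} C}
    (hA : A.IsPerfectPartitionLottery) (n : ℕ) (μ : Fin n → {μ : Valuation C // μ ≠ 0}) :
    A.welfare n μ = (n : ℝ) / 2 ^ (n - 1) := by
  set f : Fin n →₀ Valuation C := Finsupp.equivFunOnFinite.symm fun k => (μ k).1 with hf
  have hfs : f.support = Finset.univ := by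
    ext k
    simpa [hf] using (μ k).2
  have h : ∀ i : Fin n, A.payoff (μ i).1 (Finsupp.embDomain Fin.valEmbedding f) i =
      1 / 2 ^ (n - 1) := by
    intro i
    rw [hA.payoff_eq_one_div (μ i).2, Finsupp.support_embDomain, Finset.card_map, hfs,
      Finset.card_univ, Fintype.card_fin]
    have : Finsupp.embDomain Fin.valEmbedding f i = f i :=
      Finsupp.embDomain_apply_self Fin.valEmbedding f i
    rw [this]
    exact (μ i).2
  rw [welfare, Finset.sum_congr rfl fun i _ => h i]
  simp [div_eq_mul_inv]

end Mechanism

end CakeCutting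
end

/-! ### Construction of a perfect-partition lottery -/

noncomputable section
namespace CakeCutting

section EqualPartition

variable {C : Type u} [MeasurableSpace C]

/-- The empty slice. -/
def emptySlice (C : Type u) [MeasurableSpace C] : Slice C := ⟨∅, .empty⟩

/-- A partition of the cake into `n` slices that have the value `1 / n` under every nonzero
valuation in `R`. -/
structure IsEqualPartition (R : Set (Valuation C)) {n : ℕ} (D : Fin n → Slice C) : Prop where
  disjoint : ∀ i j, i ≠ j → Disjoint (D i).1 (D j).1
  cover : ⋃ i, (D i).1 = Set.univ
  fair : ∀ μ ∈ R, μ ≠ 0 → ∀ j, μ.value (D j) = 1 / (n : ℝ)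

theorem exists_isEqualPartition (v : Profile C) {n : ℕ} (hn : n ≠ 0) :
    ∃ D : Fin n → Slice C, IsEqualPartition (Set.range v) D := by
  obtain ⟨k, rfl⟩ := Nat.exists_eq_succ_of_ne_zero hn
  obtain ⟨D, hD, hdisj, hcover, hval⟩ := exists_partition_measureReal_eq_div k
    (μ := fun i : v.support => (v i).1)
    fun i => Valuation.nonatomic (Finsupp.mem_support_iff.1 i.2)
  refine ⟨fun j => ⟨D j, hD j⟩, fun i j hij => hdisj hij, hcover, ?_⟩
  rintro _ ⟨i, rfl⟩ hi j
  have := Valuation.isProbabilityMeasure hi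
  have h := hval ⟨i, Finsupp.mem_support_iff.2 hi⟩ j
  rw [probReal_univ] at h
  rw [Nat.cast_succ]
  exact h

open Classical in
/-- A choice of an equal partition; it depends on the set of reports only, not on who reports
what. -/
def equalPartition (R : Set (Valuation C)) (n : ℕ) : Fin n → Slice C :=
  -- The fallback keeps the slices disjoint for every `R`; it does not occur when `R` is the range
  -- of a profile and `n ≠ 0`.
  if h : ∃ D : Fin n → Slice C, IsEqualPartition R D then h.choose else fun _ => emptySlice C

theorem isEqualPartition_equalPartition (v : Profile C) {n : ℕ} (hn : n ≠ 0) :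
    IsEqualPartition (Set.range v) (equalPartition (Set.range v) n) := by
  have h := exists_isEqualPartition v hn
  rw [equalPartition, dif_pos h]
  exact h.choose_spec

theorem disjoint_equalPartition (R : Set (Valuation C)) {n : ℕ} {i j : Fin n} (hij : i ≠ j) :
    Disjoint (equalPartition R n i).1 (equalPartition R n j).1 := by
  unfold equalPartition
  split_ifs with h
  · exact h.choose_spec.disjoint i j hij
  · exact Set.disjoint_empty ∅

end EqualPartition

namespace Lottery

/-- The outcome of the lottery for `n` participants: a permutation and a coin. -/
abbrev Outcome (n : ℕ) : Type := Equiv.Perm (Fin n) × Bool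

instance (n : ℕ) : MeasurableSpace (Equiv.Perm (Fin n)) := ⊤

instance (n : ℕ) : DiscreteMeasurableSpace (Equiv.Perm (Fin n)) := ⟨fun _ => trivial⟩

/-- The probability that the cake is handed out to the `n` participants. -/
def coinProb (n : ℕ) : unitInterval :=
  ⟨(n : ℝ) / 2 ^ (n - 1), by positivity, by
    rw [div_le_one (by positivity)]
    rcases n with _ | k
    · simp
    · exact_mod_cast Nat.lt_two_pow_self⟩

/-- The uniform distribution on the permutations. -/
def permMeasure (n : ℕ) : Measure (Equiv.Perm (Fin n)) :=
  (PMF.uniformOfFintype (Equiv.Perm (Fin n))).toMeasure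

/-- The distribution of the coin. -/
def coinMeasure (n : ℕ) : Measure Bool :=
  ProbabilityTheory.bernoulliMeasure true false (coinProb n)

instance (n : ℕ) : IsProbabilityMeasure (permMeasure n) := by
  unfold permMeasure
  infer_instance

instance (n : ℕ) : IsProbabilityMeasure (coinMeasure n) := by
  unfold coinMeasure
  infer_instance

/-- The permutation and the coin are independent. -/
def outcomeMeasure (n : ℕ) : Measure (Outcome n) := (permMeasure n).prod (coinMeasure n)

instance (n : ℕ) : IsProbabilityMeasure (outcomeMeasure n) := by
  unfold outcomeMeasure
  infer_instance

theorem permMeasure_singleton (n : ℕ) (τ : Equiv.Perm (Fin n)) :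
    permMeasure n {τ} = (n.factorial : ENNReal)⁻¹ := by
  rw [permMeasure, PMF.toMeasure_apply_singleton _ _ (measurableSet_singleton τ)]
  simp [Fintype.card_perm]

/-- This invariance absorbs any change in the enumeration of the participants. -/
theorem measurePreserving_mulRight (n : ℕ) (ρ : Equiv.Perm (Fin n)) :
    MeasurePreserving (fun τ => τ * ρ) (permMeasure n) (permMeasure n) := by
  refine ⟨.of_discrete, Measure.ext_of_singleton fun τ => ?_⟩
  rw [Measure.map_apply .of_discrete (measurableSet_singleton τ)]
  have : (fun τ => τ * ρ) ⁻¹' {τ} = {τ * ρ⁻¹} := by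
    ext κ
    simp [eq_mul_inv_iff_mul_eq]
  rw [this, permMeasure_singleton, permMeasure_singleton]

/-- The sample space of the lottery: an independent outcome for every number of participants. -/
abbrev Sample : Type w := ULift.{w} (∀ n, Outcome n)

/-- One probability space must serve all profiles, while the permutation group and the bias of the
coin vary with `n`. Each profile reads a single coordinate, so only the marginals matter. -/
def sampleMeasure : Measure Sample.{w} :=
  (Measure.infinitePi outcomeMeasure).map ULift.up

theorem measurePreserving_down_apply (n : ℕ) :
    MeasurePreserving (fun ω : Sample.{w} => ω.down n) sampleMeasure (outcomeMeasure n) := by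
  have h1 : MeasurePreserving (ULift.down : Sample.{w} → ∀ n, Outcome n) sampleMeasure
      (Measure.infinitePi outcomeMeasure) := by
    refine ⟨measurable_down, ?_⟩
    rw [sampleMeasure, Measure.map_map measurable_down measurable_up]
    exact Measure.map_id
  exact (measurePreserving_eval_infinitePi outcomeMeasure n).comp h1

instance : IsProbabilityMeasure sampleMeasure.{w} :=
  Measure.isProbabilityMeasure_map measurable_up.aemeasurable

variable {C : Type u} [MeasurableSpace C]

/-- The slice of the identity `i` when the participants in `s` are enumerated by `e`. -/
def slot (R : Set (Valuation C)) {n : ℕ} {s : Finset ℕ} (e : s ≃ Fin n) (o : Outcome n) (i : ℕ) :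
    Slice C :=
  if h : i ∈ s then if o.2 = true then equalPartition R n (o.1 (e ⟨i, h⟩)) else emptySlice C
  else emptySlice C

theorem slot_of_notMem (R : Set (Valuation C)) {n : ℕ} {s : Finset ℕ} (e : s ≃ Fin n)
    (o : Outcome n) {i : ℕ} (hi : i ∉ s) : slot R e o i = emptySlice C := dif_neg hi

theorem slot_of_mem (R : Set (Valuation C)) {n : ℕ} {s : Finset ℕ} (e : s ≃ Fin n)
    (o : Outcome n) {i : ℕ} (hi : i ∈ s) :
    slot R e o i = if o.2 = true then equalPartition R n (o.1 (e ⟨i, hi⟩)) else emptySlice C :=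
  dif_pos hi

theorem slot_coe_of_mem (R : Set (Valuation C)) {n : ℕ} {s : Finset ℕ} (e : s ≃ Fin n)
    (o : Outcome n) {i : ℕ} (hi : i ∈ s) :
    (slot R e o i).1 = if o.2 = true then (equalPartition R n (o.1 (e ⟨i, hi⟩))).1 else ∅ := by
  rw [slot_of_mem R e o hi]
  split_ifs <;> rfl

theorem disjoint_slot (R : Set (Valuation C)) {n : ℕ} {s : Finset ℕ} (e : s ≃ Fin n)
    (o : Outcome n) {i j : ℕ} (hij : i ≠ j) : Disjoint (slot R e o i).1 (slot R e o j).1 := by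
  by_cases hi : i ∈ s
  · by_cases hj : j ∈ s
    · rw [slot_of_mem R e o hi, slot_of_mem R e o hj]
      split_ifs
      · refine disjoint_equalPartition R fun h => hij ?_
        exact congrArg Subtype.val (e.injective (o.1.injective h))
      · exact Set.disjoint_empty ∅
    · rw [slot_of_notMem R e o hj]
      exact Set.disjoint_empty _
  · rw [slot_of_notMem R e o hi]
    exact Set.empty_disjoint _

/-- The law of the allocation does not depend on the enumeration of the participants. -/
theorem map_slot_eq (R : Set (Valuation C)) {n n' : ℕ} (hn : n = n') {s s' : Finset ℕ}
    (e : s ≃ Fin n) (e' : s' ≃ Fin n') (σ : Equiv.Perm ℕ) (hs : ∀ i, i ∈ s ↔ σ i ∈ s') :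
    sampleMeasure.{w}.map (fun ω i => slot R e (ω.down n) i) =
      sampleMeasure.{w}.map (fun ω i => slot R e' (ω.down n') (σ i)) := by
  subst hn
  -- The discrepancy between the two enumerations, once participants are matched by `σ`. Renaming
  -- amounts to replacing the random permutation `τ` by `τ * ρ`, which has the same law.
  let ρ : Equiv.Perm (Fin n) := e.symm.trans ((σ.subtypeEquiv hs).trans e')
  have hρ : MeasurePreserving (Prod.map (fun τ => τ * ρ) id) (outcomeMeasure n)
      (outcomeMeasure n) :=
    (measurePreserving_mulRight n ρ).prod (.id _)
  have hslot : ∀ (o : Outcome n) i, slot R e' o (σ i) = slot R e (Prod.map (· * ρ) id o) i := by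
    intro o i
    by_cases hi : i ∈ s
    · rw [slot_of_mem R e _ hi, slot_of_mem R e' _ ((hs i).1 hi)]
      simp [ρ]
    · rw [slot_of_notMem R e _ hi, slot_of_notMem R e' _ fun h => hi ((hs i).2 h)]
  have hm : Measurable (slot R e) := .of_discrete
  have hd := measurePreserving_down_apply.{w} n
  simp only [hslot]
  calc sampleMeasure.{w}.map (slot R e ∘ fun ω => ω.down n)
      = (outcomeMeasure n).map (slot R e) := by
        rw [← Measure.map_map hm hd.measurable, hd.map_eq]
    _ = sampleMeasure.{w}.map (slot R e ∘ (Prod.map (· * ρ) id ∘ fun ω => ω.down n)) := by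
        rw [← Measure.map_map hm (hρ.measurable.comp hd.measurable), (hρ.comp hd).map_eq]

/-- A perfect-partition lottery whose partition depends on the set of reports only. -/
def mechanism (C : Type u) [MeasurableSpace C] : Mechanism.{u, w} C where
  Ω := Sample.{w}
  P := sampleMeasure
  alloc v ω i := slot (Set.range v) v.support.equivFin (ω.down v.support.card) i
  measurable_alloc v := by
    have hm : Measurable (slot (Set.range v) v.support.equivFin) := .of_discrete
    exact hm.comp (measurePreserving_down_apply v.support.card).measurable
  disjoint_alloc v ω i j hij := disjoint_slot _ _ _ hij
  alloc_inactive v ω i hi := by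
    rw [slot_of_notMem _ _ _ (Finsupp.notMem_support_iff.2 hi)]
    rfl
  symmetric v σ := by
    have hs : (Finsupp.equivMapDomain σ v).support = v.support.map σ.toEmbedding := rfl
    -- Renaming keeps the set of reports, hence the chosen partition is literally the same.
    have hR : Set.range (Finsupp.equivMapDomain σ v) = Set.range v :=
      σ.symm.surjective.range_comp v
    rw [hR]
    refine map_slot_eq _ ?_ _ _ σ fun i => ?_
    · rw [hs, Finset.card_map]
    · simp

theorem isPerfectPartitionLottery_mechanism (C : Type u) [MeasurableSpace C] :
    (mechanism.{u, w} C).IsPerfectPartitionLottery := by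
  intro v hv
  have hn : v.support.card ≠ 0 := by simpa using hv
  have hD := isEqualPartition_equalPartition v hn
  set n := v.support.card with hndef
  let e : v.support ≃ Fin n := v.support.equivFin
  have hd := measurePreserving_down_apply.{w} n
  -- The random permutation of the participants is the sampled one of `Fin n` conjugated by the
  -- enumeration `e`; its events and those of the coin are cylinders over the two factors of one
  -- coordinate, which gives uniformity and independence.
  have hσ : ∀ τ : Equiv.Perm v.support,
      {ω : Sample.{w} | (e.trans (ω.down n).1).trans e.symm = τ} =
        (fun ω => ω.down n) ⁻¹' ({(e.symm.trans τ).trans e} ×ˢ Set.univ) := by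
    intro τ
    ext ω
    simp only [Set.mem_ofPred_eq, Set.mem_preimage, Set.mem_prod, Set.mem_singleton_iff,
      Set.mem_univ, and_true]
    constructor
    · rintro rfl
      ext; simp
    · intro h
      rw [h]
      ext; simp
  have hX : {ω : Sample.{w} | (ω.down n).2 = true} =
      (fun ω => ω.down n) ⁻¹' (Set.univ ×ˢ {true}) := by
    ext ω
    simp
  have hcoin : (coinMeasure n).real {true} = (n : ℝ) / 2 ^ (n - 1) := by
    rw [coinMeasure, ProbabilityTheory.bernoulliMeasure_real_apply_of_mem_of_notMem _
      (measurableSet_singleton _) (by simp) (by simp)]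
    rfl
  have hσm : ∀ τ : Equiv.Perm v.support,
      MeasurableSet {ω : Sample.{w} | (e.trans (ω.down n).1).trans e.symm = τ} := fun τ => by
    rw [hσ]
    exact hd.measurable .of_discrete
  have hXm : MeasurableSet {ω : Sample.{w} | (ω.down n).2 = true} := by
    rw [hX]
    exact hd.measurable .of_discrete
  refine ⟨fun j => equalPartition (Set.range v) n (e j),
    fun ω => (e.trans (ω.down n).1).trans e.symm, fun ω => (ω.down n).2,
    ⟨?_, ?_, ?_⟩, hσm, hXm, fun τ => ?_, ?_, fun τ => ?_, fun ω i => ?_⟩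
  · intro i j hij
    exact hD.disjoint _ _ (e.injective.ne hij)
  · rw [← hD.cover]
    exact e.surjective.iUnion_comp fun j => (equalPartition (Set.range v) n j).1
  · intro i j
    exact hD.fair _ ⟨i, rfl⟩ (Finsupp.mem_support_iff.1 i.2) _
  · change sampleMeasure.real {ω : Sample.{w} | (e.trans (ω.down n).1).trans e.symm = τ} = _
    rw [hσ, Measure.real, hd.measure_preimage MeasurableSet.of_discrete.nullMeasurableSet,
      outcomeMeasure, Measure.prod_prod, permMeasure_singleton, measure_univ, mul_one]
    simp
  · change sampleMeasure.real {ω : Sample.{w} | (ω.down n).2 = true} = _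
    rw [hX, Measure.real, hd.measure_preimage MeasurableSet.of_discrete.nullMeasurableSet,
      outcomeMeasure, Measure.prod_prod, measure_univ, one_mul]
    exact hcoin
  · refine (ProbabilityTheory.indepSet_iff_measure_inter_eq_mul (hσm τ) hXm sampleMeasure).2 ?_
    rw [hσ, hX, ← Set.preimage_inter, Set.prod_inter_prod, Set.univ_inter, Set.inter_univ,
      hd.measure_preimage MeasurableSet.of_discrete.nullMeasurableSet,
      hd.measure_preimage MeasurableSet.of_discrete.nullMeasurableSet,
      hd.measure_preimage MeasurableSet.of_discrete.nullMeasurableSet,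
      outcomeMeasure, Measure.prod_prod, Measure.prod_prod, Measure.prod_prod, measure_univ,
      measure_univ, one_mul, mul_one]
  · refine (slot_coe_of_mem (Set.range v) e (ω.down n) i.2).trans ?_
    change _ = ite ((ω.down n).2 = true)
      (equalPartition (Set.range v) n (e (e.symm ((ω.down n).1 (e i))))).1 ∅
    rw [Equiv.apply_symm_apply]

end Lottery

end CakeCutting
end

/-! ### The main theorem -/

theorem mainTheorem4 {C : Type u} [MeasurableSpace C] :
    (∃ A : CakeCutting.Mechanism.{u, w} C, A.IsPerfectPartitionLottery) ∧
    (∀ A : CakeCutting.Mechanism.{u, w} C, A.IsPerfectPartitionLottery →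
      A.Truthful ∧ A.SybilProof ∧
        A.ProportionalInExpectation (fun n => 1 / 2 ^ (n - 1))) ∧
    ((∃ μ : CakeCutting.Valuation C, μ ≠ 0) → ∀ n : ℕ, 1 ≤ n →
      (∀ A : CakeCutting.Mechanism.{u, w} C, A.IsPerfectPartitionLottery →
        IsLeast (Set.range (A.welfare n)) ((n : ℝ) / 2 ^ (n - 1))) ∧
      IsGreatest
        {W : ℝ | ∃ A : CakeCutting.Mechanism.{u, w} C,
          A.Truthful ∧ A.SybilProof ∧ W = A.worstCaseWelfare n}
        ((n : ℝ) / 2 ^ (n - 1))) := by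
  refine ⟨⟨_, CakeCutting.Lottery.isPerfectPartitionLottery_mechanism C⟩,
    fun A hA => ⟨hA.truthful, hA.sybilProof, hA.proportionalInExpectation⟩, ?_⟩
  rintro ⟨μ, hμ⟩ n hn
  have : Nonempty (Fin n → {μ : CakeCutting.Valuation C // μ ≠ 0}) := ⟨fun _ => ⟨μ, hμ⟩⟩
  refine ⟨fun A hA => ⟨⟨fun _ => ⟨μ, hμ⟩, hA.welfare_eq n _⟩, ?_⟩, ?_, ?_⟩
  · rintro _ ⟨ν, rfl⟩
    exact (hA.welfare_eq n ν).ge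
  · have hA := CakeCutting.Lottery.isPerfectPartitionLottery_mechanism.{u, w} C
    refine ⟨_, hA.truthful, hA.sybilProof, ?_⟩
    -- The welfare of a lottery is constant in the valuations, and the index type is nonempty
    -- because `μ` exists, so the infimum is that constant.
    rw [CakeCutting.Mechanism.worstCaseWelfare, iInf_congr (hA.welfare_eq n), ciInf_const]
  · rintro _ ⟨A, -, hA, rfl⟩
    exact hA.worstCaseWelfare_le hμ hn
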